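/- For $z=(x,\omega)\in\mathbb R^2$ let $\pi(z)f(t)=e^{2\pi i\omega t}f(t-x)$ on $L^2(\mathbb R)$. Let $S_0(\mathbb R)$ be Feichtinger's algebra, i.e. the space of all $f\in L^2(\mathbb R)$ whose short-time Fourier transform $(x,\omega)\mapsto\int_{\mathbb R} f(t)e^{-\pi(t-x)^2}e^{-2\pi i\omega t}\,dt$ is integrable on $\mathbb R^2$. Let $\mathcal A_1^1=\{\sum_{k,l\in\mathbb Z}a_{kl}\pi(k,l): (a_{kl})\in\ell^1(\mathbb Z^2)\}$, an algebra of operators on $L^2(\mathbb R)$ (a copy of the Wiener algebra $A(\mathbb T^2)$ of absolutely convergent Fourier series), which acts on $S_0(\mathbb R)$. Write $(\nabla_1f)(t)=2\pi i\,t\,f(t)$ and $\nabla_2f=f'$, the derivative being taken in the sense of distributions. **Theorem.** Let $g\in S_0(\mathbb R)$ be a generator of the $\mathcal A_1^1$-module $S_0(\mathbb R)$, i.e. every $f\in S_0(\mathbb R)$ is of the form $f=\sum_{k,l}a_{kl}\pi(k,l)g$ with $(a_{kl})\in\ell^1(\mathbb Z^2)$. Suppose that the Gabor system $\{\pi(k,l)g:k,l\in\mathbb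 Z\}$ is a Riesz basis for $L^2(\mathbb R)$, and let $h=S^{-1}g$ be the canonical dual atom, where $Sf=\sum_{k,l}\langle f,\pi(k,l)g\rangle\,\pi(k,l)g$ is the frame operator of this system. Then $\nabla_1g\notin S_0(\mathbb R)$ or $\nabla_2h\notin S_0(\mathbb R)$. -/

import Mathlib

open MeasureTheory

open scoped ENNReal ContDiff

noncomputable section

namespace BalianLow

/-- The Hilbert space `L²(ℝ)` of complex-valued square-integrable functions. -/
abbrev L2 : Type := Lp ℂ 2 (volume : Measure ℝ)

/-- The function `t ↦ e^{2π i ω t} f(t - x)`, for `z = (x, ω)`. -/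
def shiftFun (z : ℝ × ℝ) (f : ℝ → ℂ) (t : ℝ) : ℂ :=
  Complex.exp (2 * Real.pi * Complex.I * z.2 * t) * f (t - z.1)

theorem norm_shiftFun (z : ℝ × ℝ) (f : ℝ → ℂ) (t : ℝ) :
    ‖shiftFun z f t‖ = ‖f (t - z.1)‖ := by
  have h : (2 * Real.pi * Complex.I * z.2 * t : ℂ)
      = ((2 * Real.pi * z.2 * t : ℝ) : ℂ) * Complex.I := by
    push_cast; ring
  rw [shiftFun, norm_mul, h, Complex.norm_exp_ofReal_mul_I, one_mul]

theorem memLp_shiftFun (z : ℝ × ℝ) {f : ℝ → ℂ} (hf : MemLp f 2 volume) :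
    MemLp (shiftFun z f) 2 volume := by
  have h1 : MemLp (fun t => f (t - z.1)) 2 volume :=
    hf.comp_measurePreserving (measurePreserving_sub_right volume z.1)
  refine h1.congr_norm ?_ (Filter.Eventually.of_forall fun t => (norm_shiftFun z f t).symm)
  exact AEStronglyMeasurable.mul
    (Continuous.aestronglyMeasurable (by fun_prop)) h1.aestronglyMeasurable

theorem shiftFun_congr (z : ℝ × ℝ) {f f' : ℝ → ℂ} (h : f =ᵐ[volume] f') :
    shiftFun z f =ᵐ[volume] shiftFun z f' := by
  have h1 := (measurePreserving_sub_right (volume : Measure ℝ) z.1).quasiMeasurePreserving.ae_eq_comp h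
  filter_upwards [h1] with t ht
  simp only [Function.comp_apply] at ht
  simp only [shiftFun, ht]

/-- The time-frequency shift `π(z)`, `z = (x, ω)`, as a linear isometry of `L²(ℝ)`. -/
def tfShift (z : ℝ × ℝ) : L2 →ₗᵢ[ℂ] L2 where
  toFun f := (memLp_shiftFun z (Lp.memLp f)).toLp (shiftFun z f)
  map_add' f g := by
    rw [← MemLp.toLp_add]
    refine MemLp.toLp_congr _ _ ((shiftFun_congr z (Lp.coeFn_add f g)).trans ?_)
    refine Filter.Eventually.of_forall fun t => ?_
    simp only [shiftFun, Pi.add_apply, mul_add]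
  map_smul' c f := by
    simp only [RingHom.id_apply]
    rw [← MemLp.toLp_const_smul]
    refine MemLp.toLp_congr _ _ ((shiftFun_congr z (Lp.coeFn_smul c f)).trans ?_)
    refine Filter.Eventually.of_forall fun t => ?_
    simp only [shiftFun, Pi.smul_apply, smul_eq_mul]
    ring
  norm_map' f := by
    change ‖(memLp_shiftFun z (Lp.memLp f)).toLp (shiftFun z f)‖ = ‖f‖
    rw [Lp.norm_toLp, Lp.norm_def]
    congr 1
    rw [eLpNorm_congr_norm_ae (g := (f : ℝ → ℂ) ∘ fun t => t - z.1)
      (Filter.Eventually.of_forall fun t => norm_shiftFun z f t)]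
    exact eLpNorm_comp_measurePreserving (Lp.aestronglyMeasurable f)
      (measurePreserving_sub_right volume z.1)

/-- `π(z) f (t) = e^{2π i ω t} f(t - x)` for almost every `t`. -/
theorem tfShift_ae (z : ℝ × ℝ) (f : L2) : tfShift z f =ᵐ[volume] shiftFun z f :=
  (memLp_shiftFun z (Lp.memLp f)).coeFn_toLp

/-- The operators `π(k, l)` for the integer lattice. -/
def latticeShift (p : ℤ × ℤ) : L2 →L[ℂ] L2 :=
  (tfShift ((p.1 : ℝ), (p.2 : ℝ))).toContinuousLinearMap

/-- The short-time Fourier transform with Gaussian window,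
`V f (x, ω) = ∫ f(t) e^{-π (t - x)²} e^{-2π i ω t} dt`. -/
def stft (f : ℝ → ℂ) (z : ℝ × ℝ) : ℂ :=
  ∫ t : ℝ, f t * Complex.exp (-Real.pi * ((t : ℂ) - z.1) ^ 2)
    * Complex.exp (-2 * Real.pi * Complex.I * z.2 * t)

/-- Feichtinger's algebra `S₀(ℝ)`: the `f ∈ L²(ℝ)` whose short-time Fourier transform is
integrable over the time-frequency plane. The condition depends on `f` only up to equality
almost everywhere. -/
def MemS0 (f : ℝ → ℂ) : Prop :=
  MemLp f 2 volume ∧ Integrable (stft f) (volume : Measure (ℝ × ℝ))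

/-- The algebra `𝒜₁¹` of the operators `∑ a_{kl} π(k, l)` on `L²(ℝ)` with `a ∈ ℓ¹(ℤ²)`, the series
converging in operator norm. The `π(k, l)` commute, and this is a copy of the Wiener algebra of
absolutely convergent Fourier series on the two-dimensional torus. -/
def wienerAlgebra : Set (L2 →L[ℂ] L2) :=
  {T | ∃ a : ℤ × ℤ → ℂ, Summable (fun p => ‖a p‖) ∧ HasSum (fun p => a p • latticeShift p) T}

/-- `g` is a single generator of the `𝒜₁¹`-module `S₀(ℝ)`. -/
def IsS0Generator (g : L2) : Prop :=
  MemS0 g ∧ ∀ f : L2, MemS0 f → ∃ T ∈ wienerAlgebra, T g = f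

/-- The Gabor system `{π(k, l) g : k, l ∈ ℤ}` is a Riesz basis for `L²(ℝ)`. -/
def IsGaborRieszBasis (g : L2) : Prop :=
  Dense (Submodule.span ℂ (Set.range fun p : ℤ × ℤ => latticeShift p g) : Set L2) ∧
  ∃ A B : ℝ, 0 < A ∧ ∀ c : (ℤ × ℤ) →₀ ℂ,
    A * ∑ p ∈ c.support, ‖c p‖ ^ 2 ≤ ‖∑ p ∈ c.support, c p • latticeShift p g‖ ^ 2 ∧
    ‖∑ p ∈ c.support, c p • latticeShift p g‖ ^ 2 ≤ B * ∑ p ∈ c.support, ‖c p‖ ^ 2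

/-- `S f = u` for the Gabor frame operator `S f = ∑ ⟨f, π(k, l) g⟩ π(k, l) g` of `g`, the series
converging unconditionally in `L²(ℝ)`. (Mathlib's inner product is conjugate-linear in the first
argument.) -/
def FrameOperatorEq (g f u : L2) : Prop :=
  HasSum (fun p : ℤ × ℤ => inner ℂ (latticeShift p g) f • latticeShift p g) u

/-- `h = S⁻¹ g`, that is `S h = g`; `S` is invertible when `g` generates a Gabor Riesz basis. -/
def IsCanonicalDual (g h : L2) : Prop := FrameOperatorEq g h g

/-- `∇₁ f (t) = 2π i t f(t)`. -/
def nabla1 (f : ℝ → ℂ) (t : ℝ) : ℂ := 2 * Real.pi * Complex.I * t * f t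

/-- `u` is the weak (distributional) derivative `∇₂ f = f'` of `f`. -/
def IsNabla2 (f u : ℝ → ℂ) : Prop :=
  LocallyIntegrable f volume ∧ LocallyIntegrable u volume ∧
  ∀ φ : ℝ → ℂ, ContDiff ℝ ∞ φ → HasCompactSupport φ →
    ∫ t : ℝ, f t * deriv φ t = -∫ t : ℝ, u t * φ t

/-- `∇₂ f ∈ S₀(ℝ)`: the distributional derivative of `f` is an element of `S₀(ℝ)`. -/
def Nabla2MemS0 (f : ℝ → ℂ) : Prop := ∃ u : ℝ → ℂ, IsNabla2 f u ∧ MemS0 u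

end BalianLow

end

/-! Write `T_s = π(s, 0)`, `M_s = π(0, s)`, `a = M_s g - g` and `b = T_s h - h`. The systems
generated by `g` and `h` are biorthogonal bases, so `⟨b, a⟩ = ∑ ⟨b, Λ g⟩ ⟨Λ h, a⟩` over the lattice
shifts `Λ = π(k, l)`. Since `T_s` and `M_s` commute with `Λ` up to a phase,
`⟨M_{-s} h - h, T_{-s} g - g⟩` has the same expansion with the terms multiplied by
`e^{-2πi s (k + l)}`. If `∇₁ g` and `∇₂ h` are in `L²`, then `a / s` converges and `b / s` stays
bounded, and as these phases tend to `1` the difference of the two inner products is `o(s²)`. By the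
commutation relation of `T_s` and `M_s` that difference equals
`(1 - e^{-2πi s²}) ⟨T_s h, M_s g⟩`, which is asymptotic to `2πi s² ⟨h, g⟩ = 2πi s²`, a
contradiction. -/

noncomputable section

namespace BalianLow

open Filter Topology

open scoped ComplexConjugate FourierTransform Convolution

section RieszPairs

variable {𝕜 ι E : Type*} [RCLike 𝕜] [NormedAddCommGroup E] [InnerProductSpace 𝕜 E]

variable (𝕜) in
/-- A Bessel family: the coefficients `⟨v p, f⟩` are square-summable, with `ℓ²`-norm bounded by a
multiple of `‖f‖`. -/
def IsBessel (v : ι → E) : Prop :=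
  ∃ C : ℝ, ∀ (f : E) (s : Finset ι), ∑ p ∈ s, ‖inner 𝕜 (v p) f‖ ^ 2 ≤ C * ‖f‖ ^ 2

variable (𝕜) in
/-- The upper bound in the definition of a Riesz sequence, for coefficients indexed by finite
sets. -/
def HasUpperRieszBound (v : ι → E) (B : ℝ) : Prop :=
  ∀ (s : Finset ι) (c : ι → 𝕜), ‖∑ p ∈ s, c p • v p‖ ^ 2 ≤ B * ∑ p ∈ s, ‖c p‖ ^ 2

variable (𝕜) in
/-- The lower bound in the definition of a Riesz sequence, for coefficients indexed by finite
sets. -/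
def HasLowerRieszBound (v : ι → E) (A : ℝ) : Prop :=
  ∀ (s : Finset ι) (c : ι → 𝕜), A * ∑ p ∈ s, ‖c p‖ ^ 2 ≤ ‖∑ p ∈ s, c p • v p‖ ^ 2

variable (𝕜) in
/-- Two families in duality as a Riesz basis `v` and its dual basis `w`: both are Bessel, `v` is
complete, and they are biorthogonal. -/
structure IsRieszPair [DecidableEq ι] (v w : ι → E) : Prop where
  isBessel_left : IsBessel 𝕜 v
  isBessel_right : IsBessel 𝕜 w
  dense_span : Dense (Submodule.span 𝕜 (Set.range v) : Set E)
  inner_eq : ∀ p q, inner 𝕜 (w p) (v q) = if p = q then 1 else 0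

theorem HasUpperRieszBound.isBessel {v : ι → E} {B : ℝ} (hB : HasUpperRieszBound 𝕜 v B) :
    IsBessel 𝕜 v := by
  refine ⟨|B|, fun f s => ?_⟩
  set σ : ℝ := ∑ p ∈ s, ‖inner 𝕜 (v p) f‖ ^ 2 with hσ
  have hσ0 : 0 ≤ σ := Finset.sum_nonneg fun p _ => by positivity
  set y : E := ∑ p ∈ s, inner 𝕜 (v p) f • v p with hy
  have hyf : inner 𝕜 y f = (σ : 𝕜) := by
    simp only [hy, sum_inner, inner_smul_left, RCLike.conj_mul, hσ, map_sum, map_pow]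
  have hy_le : ‖y‖ ^ 2 ≤ |B| * σ := (hB s _).trans (by gcongr; exact le_abs_self B)
  have hσ_le : σ ≤ ‖y‖ * ‖f‖ := by
    simpa [hyf, abs_of_nonneg hσ0] using norm_inner_le_norm (𝕜 := 𝕜) y f
  rcases hσ0.eq_or_lt with h0 | hpos
  · rw [← h0]
    positivity
  · refine le_of_mul_le_mul_right ?_ hpos
    calc σ * σ ≤ (‖y‖ * ‖f‖) * (‖y‖ * ‖f‖) := mul_self_le_mul_self hσ0 hσ_le
      _ = ‖y‖ ^ 2 * ‖f‖ ^ 2 := by ring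
      _ ≤ (|B| * σ) * ‖f‖ ^ 2 := by gcongr
      _ = |B| * ‖f‖ ^ 2 * σ := by ring

theorem HasLowerRieszBound.eq_zero_of_hasSum {v : ι → E} {A : ℝ} (hv : HasLowerRieszBound 𝕜 v A)
    (hA : 0 < A) {c : ι → 𝕜} (hc : HasSum (fun p => c p • v p) 0) : c = 0 := by
  funext p
  have hlim : Tendsto (fun s : Finset ι => ‖∑ q ∈ s, c q • v q‖ ^ 2) atTop (𝓝 0) := by
    simpa using (Tendsto.norm hc).pow 2
  have hle : A * ‖c p‖ ^ 2 ≤ 0 := by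
    refine ge_of_tendsto hlim ?_
    filter_upwards [eventually_ge_atTop {p}] with s hs
    refine le_trans ?_ (hv s c)
    gcongr
    exact Finset.single_le_sum (f := fun q => ‖c q‖ ^ 2) (fun _ _ => by positivity)
      (hs (Finset.mem_singleton_self p))
  have h0 : ‖c p‖ ^ 2 ≤ 0 := nonpos_of_mul_nonpos_right hle hA
  exact norm_eq_zero.mp (pow_eq_zero_iff two_ne_zero |>.mp (h0.antisymm (by positivity)))

theorem HasLowerRieszBound.eq_single_of_hasSum [DecidableEq ι] {v : ι → E} {A : ℝ}
    (hv : HasLowerRieszBound 𝕜 v A) (hA : 0 < A) {c : ι → 𝕜} {q : ι}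
    (hc : HasSum (fun p => c p • v p) (v q)) : c = Pi.single q 1 := by
  have hq : HasSum (fun p => (Pi.single q 1 : ι → 𝕜) p • v p) (v q) := by
    simpa using hasSum_single (f := fun p => (Pi.single q 1 : ι → 𝕜) p • v p) q
      fun p hp => by simp [hp]
  refine sub_eq_zero.mp (hv.eq_zero_of_hasSum hA ?_)
  simpa [sub_smul] using hc.sub hq

theorem HasLowerRieszBound.isBessel_of_biorthogonal [DecidableEq ι] {v w : ι → E} {A : ℝ}
    (hv : HasLowerRieszBound 𝕜 v A) (hA : 0 < A)
    (hd : Dense (Submodule.span 𝕜 (Set.range v) : Set E))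
    (hvw : ∀ p q, inner 𝕜 (w p) (v q) = if p = q then 1 else 0) : IsBessel 𝕜 w := by
  refine ⟨A⁻¹, fun f s => ?_⟩
  refine hd.induction (P := fun f => ∑ p ∈ s, ‖inner 𝕜 (w p) f‖ ^ 2 ≤ A⁻¹ * ‖f‖ ^ 2) ?_
    (isClosed_le (by fun_prop) (by fun_prop)) f
  intro x hx
  obtain ⟨c, rfl⟩ := Finsupp.mem_span_range_iff_exists_finsupp.mp hx
  have hcoef : ∀ p, inner 𝕜 (w p) (c.sum fun q a => a • v q) = c p := fun p => by
    simp +contextual [Finsupp.sum, inner_sum, inner_smul_right, hvw, eq_comm]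
  have hsum : c.sum (fun q a => a • v q) = ∑ q ∈ c.support ∪ s, c q • v q :=
    Finsupp.sum_of_support_subset c Finset.subset_union_left _ (by simp)
  simp only [hcoef]
  rw [le_inv_mul_iff₀ hA, hsum]
  refine le_trans ?_ (hv _ c)
  gcongr
  exact Finset.subset_union_right

/-- The analysis operator `f ↦ (⟨v p, f⟩)_p` of a Bessel family. -/
def IsBessel.analysis {v : ι → E} (hv : IsBessel 𝕜 v) : E →L[𝕜] lp (fun _ : ι => 𝕜) 2 :=
  LinearMap.mkContinuousOfExistsBound
    { toFun := fun f => ⟨fun p => inner 𝕜 (v p) f, by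
        obtain ⟨C, hC⟩ := hv
        exact memℓp_gen' (C := C * ‖f‖ ^ 2) fun s => by simpa using hC f s⟩
      map_add' := fun f g => by ext p; exact inner_add_right _ _ _
      map_smul' := fun a f => by ext p; exact inner_smul_right _ _ _ }
    (by
      obtain ⟨C, hC⟩ := hv
      refine ⟨√C, fun f => lp.norm_le_of_forall_sum_le (by simp) (by positivity) fun s => ?_⟩
      have hC' : C * ‖f‖ ^ 2 ≤ (√C * ‖f‖) ^ 2 := by
        rw [mul_pow, Real.sq_sqrt']
        gcongr
        exact le_max_left _ _
      simpa using (hC f s).trans hC')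

@[simp]
theorem IsBessel.analysis_apply {v : ι → E} (hv : IsBessel 𝕜 v) (f : E) (p : ι) :
    hv.analysis f p = inner 𝕜 (v p) f := rfl

namespace IsRieszPair

variable [DecidableEq ι] {v w : ι → E}

theorem analysis_right_apply (h : IsRieszPair 𝕜 v w) (q : ι) :
    h.isBessel_right.analysis (v q) = lp.single 2 q 1 := by
  ext p
  simp [h.inner_eq, Pi.single_apply]

theorem inner_analysis_analysis (h : IsRieszPair 𝕜 v w) (x y : E) :
    inner 𝕜 (h.isBessel_left.analysis x) (h.isBessel_right.analysis y) = inner 𝕜 x y := by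
  have hxy : (innerSL 𝕜 (h.isBessel_left.analysis x)).comp h.isBessel_right.analysis
      = innerSL 𝕜 x := by
    refine ContinuousLinearMap.ext_on h.dense_span ?_
    rintro _ ⟨q, rfl⟩
    simp [h.analysis_right_apply, lp.inner_single_right]
  exact congrArg (· y) hxy

theorem hasSum_inner_mul_inner (h : IsRieszPair 𝕜 v w) (x y : E) :
    HasSum (fun p => inner 𝕜 x (v p) * inner 𝕜 (w p) y) (inner 𝕜 x y) := by
  have := lp.hasSum_inner (𝕜 := 𝕜) (h.isBessel_left.analysis x) (h.isBessel_right.analysis y)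
  simpa [h.inner_analysis_analysis, mul_comm] using this

end IsRieszPair

end RieszPairs

section StrongConvergence

variable {𝕜 α κ : Type*} [NontriviallyNormedField 𝕜] {E F : α → Type*}
  [∀ i, NormedAddCommGroup (E i)] [∀ i, NormedSpace 𝕜 (E i)]
  [∀ i, NormedAddCommGroup (F i)] [∀ i, NormedSpace 𝕜 (F i)]
  {p : ℝ≥0∞} [Fact (1 ≤ p)] {l : Filter κ} {T : κ → ∀ i, E i →L[𝕜] F i} {K : ℝ}

theorem tendsto_mapCLM_apply_zero (hp : p ≠ ⊤) (hK : 0 ≤ K) (hT : ∀ s i, ‖T s i‖ ≤ K)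
    (hlim : ∀ i x, Tendsto (fun s => T s i x) l (𝓝 0)) (d : lp E p) :
    Tendsto (fun s => lp.mapCLM p (T s) hK (hT s) d) l (𝓝 0) := by
  have hp0 : 0 < p.toReal := ENNReal.toReal_pos (zero_lt_one.trans_le Fact.out).ne' hp
  have hsum : Summable fun i => (K * ‖d i‖) ^ p.toReal := by
    simpa only [Real.mul_rpow hK (norm_nonneg _)]
      using ((lp.memℓp d).summable hp0).mul_left (K ^ p.toReal)
  have hterm : Tendsto (fun s => ∑' i, ‖T s i (d i)‖ ^ p.toReal) l (𝓝 0) := by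
    rw [← tsum_zero (α := ℝ) (β := α)]
    refine tendsto_tsum_of_dominated_convergence hsum (fun i => ?_)
      (Eventually.of_forall fun s i => ?_)
    · simpa [hp0.ne'] using (hlim i (d i)).norm.rpow_const (p := p.toReal) (Or.inr hp0.le)
    · rw [Real.norm_of_nonneg (by positivity)]
      gcongr
      exact (T s i).le_of_opNorm_le (hT s i) _
  rw [tendsto_zero_iff_norm_tendsto_zero]
  simp only [lp.norm_eq_tsum_rpow hp0, lp.mapCLM_apply_coe]
  simpa [hp0.ne'] using hterm.rpow_const (p := 1 / p.toReal) (Or.inr (by positivity))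

theorem tendsto_mapCLM_zero (hp : p ≠ ⊤) (hK : 0 ≤ K) (hT : ∀ s i, ‖T s i‖ ≤ K)
    (hlim : ∀ i x, Tendsto (fun s => T s i x) l (𝓝 0)) {c : κ → lp E p} {d : lp E p}
    (hc : Tendsto c l (𝓝 d)) :
    Tendsto (fun s => lp.mapCLM p (T s) hK (hT s) (c s)) l (𝓝 0) := by
  have hdiff : Tendsto (fun s => lp.mapCLM p (T s) hK (hT s) (c s - d)) l (𝓝 0) := by
    refine squeeze_zero_norm (fun s => (lp.mapCLM p (T s) hK (hT s)).le_of_opNorm_le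
      (lp.norm_mapCLM_le p (T s) hK (hT s)) _) ?_
    simpa using (tendsto_iff_norm_sub_tendsto_zero.mp hc).const_mul K
  simpa using hdiff.add (tendsto_mapCLM_apply_zero hp hK hT hlim d)

end StrongConvergence

theorem tendsto_eLpNorm_zero_of_dominated {α ι E : Type*} {m : MeasurableSpace α} {μ : Measure α}
    [NormedAddCommGroup E] {l : Filter ι} [l.IsCountablyGenerated] {p : ℝ≥0∞} (hp0 : p ≠ 0)
    (hp : p ≠ ⊤) {F : ι → α → E} {bound : α → ℝ}
    (hF : ∀ᶠ i in l, AEStronglyMeasurable (F i) μ) (hbound : MemLp bound p μ)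
    (hle : ∀ᶠ i in l, ∀ᵐ a ∂μ, ‖F i a‖ ≤ bound a)
    (hlim : ∀ᵐ a ∂μ, Tendsto (fun i => F i a) l (𝓝 0)) :
    Tendsto (fun i => eLpNorm (F i) p μ) l (𝓝 0) := by
  have hpos : 0 < p.toReal := ENNReal.toReal_pos hp0 hp
  have hlint : Tendsto (fun i => ∫⁻ a, ‖F i a‖ₑ ^ p.toReal ∂μ) l (𝓝 (∫⁻ _, 0 ∂μ)) := by
    refine tendsto_lintegral_filter_of_dominated_convergence' (fun a => ‖bound a‖ₑ ^ p.toReal)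
      (hF.mono fun i hi => hi.enorm.pow_const _) ?_
      (lintegral_rpow_enorm_lt_top_of_eLpNorm_lt_top hp0 hp hbound.eLpNorm_lt_top).ne ?_
    · filter_upwards [hle] with i hi
      filter_upwards [hi] with a ha
      gcongr
      exact enorm_le_iff_norm_le.mpr (ha.trans (le_abs_self _))
    · filter_upwards [hlim] with a ha
      simpa [Function.comp_def, hpos] using
        (ENNReal.continuous_rpow_const (y := p.toReal)).tendsto _ |>.comp ha.enorm
  simp only [eLpNorm_eq_lintegral_rpow_enorm_toReal hp0 hp]
  simpa [Function.comp_def, hpos] using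
    (ENNReal.continuous_rpow_const (y := 1 / p.toReal)).tendsto _ |>.comp hlint


section TimeFrequency

theorem fourierChar_intCast (n : ℤ) : Real.fourierChar (n : ℝ) = 1 := by
  ext
  rw [Real.fourierChar_apply, Circle.coe_one, Complex.exp_eq_one_iff]
  exact ⟨n, by push_cast; ring⟩

theorem norm_fourierChar_sub_one_le (x : ℝ) : ‖(𝐞 x : ℂ) - 1‖ ≤ 2 * Real.pi * |x| := by
  rw [Real.fourierChar_apply, mul_comm]
  refine Real.norm_exp_I_mul_ofReal_sub_one_le.trans_eq ?_
  rw [Real.norm_eq_abs, abs_mul, abs_of_pos Real.two_pi_pos]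

theorem coe_fourierChar_add (x y : ℝ) : (𝐞 (x + y) : ℂ) = 𝐞 x * 𝐞 y := by
  rw [AddChar.map_add_eq_mul, Circle.coe_mul]

theorem conj_fourierChar (x : ℝ) : conj (𝐞 x : ℂ) = 𝐞 (-x) := by
  rw [AddChar.map_neg_eq_inv, Circle.coe_inv_eq_conj]

theorem shiftFun_eq (z : ℝ × ℝ) (f : ℝ → ℂ) (t : ℝ) :
    shiftFun z f t = 𝐞 (z.2 * t) * f (t - z.1) := by
  rw [shiftFun, Real.fourierChar_apply]
  push_cast
  ring_nf

theorem tfShift_tfShift (z w : ℝ × ℝ) (f : L2) :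
    tfShift z (tfShift w f) = (𝐞 (-(z.1 * w.2)) : ℂ) • tfShift (z + w) f := by
  apply Lp.ext
  filter_upwards [tfShift_ae z (tfShift w f), shiftFun_congr z (tfShift_ae w f),
    Lp.coeFn_smul (𝐞 (-(z.1 * w.2)) : ℂ) (tfShift (z + w) f), tfShift_ae (z + w) f]
    with t hzw hw hsmul hadd
  rw [hzw, hw, hsmul, Pi.smul_apply, hadd, shiftFun_eq, shiftFun_eq, shiftFun_eq, smul_eq_mul,
    ← mul_assoc, ← mul_assoc, ← coe_fourierChar_add, ← coe_fourierChar_add, Prod.snd_add,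
    Prod.fst_add, sub_add_eq_sub_sub]
  ring_nf

@[simp]
theorem tfShift_zero (f : L2) : tfShift 0 f = f := by
  apply Lp.ext
  filter_upwards [tfShift_ae 0 f] with t ht
  simp [ht, shiftFun_eq]

theorem inner_tfShift_tfShift (z w : ℝ × ℝ) (f g : L2) :
    inner ℂ (tfShift z f) (tfShift w g)
      = 𝐞 (w.1 * (w.2 - z.2)) * inner ℂ (tfShift (z - w) f) g := by
  have hz : tfShift z f = (𝐞 (w.1 * (z.2 - w.2)) : ℂ) • tfShift w (tfShift (z - w) f) := by
    rw [tfShift_tfShift, smul_smul, ← coe_fourierChar_add, add_sub_cancel, Prod.snd_sub,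
      add_neg_cancel]
    simp
  rw [hz, inner_smul_left, conj_fourierChar, LinearIsometry.inner_map_map]
  ring_nf

theorem inner_tfShift_tfShift_neg (z w : ℝ × ℝ) (f g : L2) :
    inner ℂ (tfShift w f) (tfShift z g)
      = 𝐞 ((w.1 + z.1) * (z.2 - w.2)) * inner ℂ (tfShift (-z) f) (tfShift (-w) g) := by
  rw [inner_tfShift_tfShift, inner_tfShift_tfShift, ← mul_assoc, ← coe_fourierChar_add,
    neg_sub_neg, Prod.fst_neg, Prod.snd_neg, Prod.snd_neg]
  ring_nf

theorem latticeShift_apply (p : ℤ × ℤ) (f : L2) :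
    latticeShift p f = tfShift ((p.1 : ℝ), (p.2 : ℝ)) f := rfl

@[simp]
theorem latticeShift_zero (f : L2) : latticeShift 0 f = f := by
  simp [latticeShift_apply, ← Prod.zero_eq_mk]

theorem inner_latticeShift_latticeShift (p q : ℤ × ℤ) (f g : L2) :
    inner ℂ (latticeShift p f) (latticeShift q g) = inner ℂ (latticeShift (p - q) f) g := by
  have hphase := fourierChar_intCast (q.1 * (q.2 - p.2))
  push_cast at hphase
  simp [latticeShift_apply, inner_tfShift_tfShift, hphase]

theorem inner_latticeShift_tfShift {z : ℝ × ℝ} (hz : z.1 * z.2 = 0) (p : ℤ × ℤ) (f g : L2) :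
    inner ℂ (latticeShift p f) (tfShift z g)
      = 𝐞 (p.1 * z.2 - z.1 * p.2) * inner ℂ (tfShift (-z) f) (latticeShift (-p) g) := by
  have hphase : 𝐞 ((p.1 + z.1) * (z.2 - p.2)) = 𝐞 (p.1 * z.2 - z.1 * p.2) := by
    have hint := fourierChar_intCast (-(p.1 * p.2))
    push_cast at hint
    rw [show (p.1 + z.1) * (z.2 - p.2) = (p.1 * z.2 - z.1 * p.2) + -(p.1 * p.2) by
      linear_combination hz, AddChar.map_add_eq_mul, hint, mul_one]
  simp [latticeShift_apply, inner_tfShift_tfShift_neg z, hphase]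

theorem inner_tfShift_sub_sub_inner_tfShift_sub (f g : L2) (s : ℝ) :
    inner ℂ (tfShift (s, 0) f - f) (tfShift (0, s) g - g)
      - inner ℂ (tfShift (0, -s) f - f) (tfShift (-s, 0) g - g)
      = (1 - (𝐞 (-s ^ 2) : ℂ)) * inner ℂ (tfShift (s, 0) f) (tfShift (0, s) g) := by
  have htrans : inner ℂ (tfShift (s, 0) f) g = inner ℂ f (tfShift (-s, 0) g) := by
    simpa [← Prod.zero_eq_mk] using inner_tfShift_tfShift_neg 0 (s, 0) f g
  have hmod : inner ℂ f (tfShift (0, s) g) = inner ℂ (tfShift (0, -s) f) g := by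
    simpa [← Prod.zero_eq_mk] using inner_tfShift_tfShift_neg (0, s) 0 f g
  have hccr : inner ℂ (tfShift (0, -s) f) (tfShift (-s, 0) g)
      = 𝐞 (-s ^ 2) * inner ℂ (tfShift (s, 0) f) (tfShift (0, s) g) := by
    simpa [sq] using inner_tfShift_tfShift_neg (-s, 0) (0, -s) f g
  simp only [inner_sub_left, inner_sub_right, htrans, hmod, hccr]
  ring

end TimeFrequency

section Increments

theorem tendsto_inv_mul_fourierChar_sub_one (t : ℝ) :
    Tendsto (fun s : ℝ => (s : ℂ)⁻¹ * ((𝐞 (s * t) : ℂ) - 1)) (𝓝[≠] 0)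
      (𝓝 (2 * Real.pi * Complex.I * t)) := by
  have hderiv : HasDerivAt (fun s : ℝ => (𝐞 (s * t) : ℂ)) (2 * Real.pi * Complex.I * t) 0 := by
    simpa [Function.comp_def, mul_comm] using
      (Real.hasDerivAt_fourierChar (0 * t)).scomp (0 : ℝ) (hasDerivAt_mul_const t)
  simpa using hderiv.tendsto_slope_zero

theorem norm_inv_mul_fourierChar_sub_one_le (s t : ℝ) :
    ‖(s : ℂ)⁻¹ * ((𝐞 (s * t) : ℂ) - 1)‖ ≤ 2 * Real.pi * |t| := by
  rcases eq_or_ne s 0 with rfl | hs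
  · simpa using (by positivity : 0 ≤ 2 * Real.pi * |t|)
  · rw [norm_mul, norm_inv, Complex.norm_real, Real.norm_eq_abs,
      inv_mul_le_iff₀ (abs_pos.mpr hs)]
    refine (norm_fourierChar_sub_one_le _).trans_eq ?_
    rw [abs_mul]
    ring

theorem hasDerivAt_modulation {f : L2} (hf : MemLp (nabla1 f) 2 volume) :
    HasDerivAt (fun s : ℝ => tfShift (0, s) f) (hf.toLp (nabla1 f)) 0 := by
  rw [hasDerivAt_iff_tendsto_slope_zero]
  apply Lp.tendsto_Lp_of_tendsto_eLpNorm
  let D (s t : ℝ) : ℂ := (s : ℂ)⁻¹ * ((𝐞 (s * t) : ℂ) - 1)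
  have hslope (s : ℝ) : s⁻¹ • (tfShift (0, 0 + s) f - tfShift (0, 0) f)
      =ᵐ[volume] fun t => D s t * f t := by
    rw [zero_add, ← Prod.zero_eq_mk, tfShift_zero]
    filter_upwards [Lp.coeFn_smul s⁻¹ (tfShift (0, s) f - f), Lp.coeFn_sub (tfShift (0, s) f) f,
      tfShift_ae (0, s) f] with t hsmul hsub hshift
    rw [hsmul, Pi.smul_apply, hsub, Pi.sub_apply, hshift, shiftFun_eq, Complex.real_smul, sub_zero]
    push_cast
    ring
  refine Tendsto.congr (fun s => (eLpNorm_congr_ae ((hslope s).sub .rfl)).symm) ?_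
  refine tendsto_eLpNorm_zero_of_dominated (by simp) (by simp)
    (.of_forall fun s => ?_) (hf.norm.const_mul 2)
    (.of_forall fun s => .of_forall fun t => ?_) (.of_forall fun t => ?_)
  · exact ((by fun_prop : Continuous (D s)).aestronglyMeasurable.mul
      (Lp.aestronglyMeasurable f)).sub hf.aestronglyMeasurable
  · have hD : ‖D s t * f t‖ ≤ ‖nabla1 f t‖ := by
      simpa [D, nabla1, abs_of_pos Real.pi_pos] using
        mul_le_mul_of_nonneg_right (norm_inv_mul_fourierChar_sub_one_le s t) (norm_nonneg (f t))
    rw [two_mul]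
    exact (norm_sub_le _ _).trans (by gcongr)
  · simpa [nabla1] using
      ((tendsto_inv_mul_fourierChar_sub_one t).mul_const (f t)).sub_const (nabla1 f t)

theorem IsNabla2.congr_right {f u u' : ℝ → ℂ} (h : IsNabla2 f u) (hu : u =ᵐ[volume] u') :
    IsNabla2 f u' := by
  refine ⟨h.1, h.2.1.congr hu, fun φ hφ hc => ?_⟩
  rw [h.2.2 φ hφ hc]
  congr 1
  exact integral_congr_ae (hu.mul .rfl)

theorem IsNabla2.hasDerivAt_convolution {f u η : ℝ → ℂ} (h : IsNabla2 f u) (hη : ContDiff ℝ ∞ η)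
    (hc : HasCompactSupport η) (x : ℝ) :
    HasDerivAt (f ⋆[.mul ℝ ℂ] η) ((u ⋆[.mul ℝ ℂ] η) x) x := by
  have hweak := h.2.2 (fun t => η (x - t)) (hη.comp (contDiff_const.sub contDiff_id))
    (hc.comp_homeomorph (Homeomorph.subLeft x))
  simp only [deriv_comp_const_sub, mul_neg, integral_neg, neg_inj] at hweak
  refine (hc.hasDerivAt_convolution_right (.mul ℝ ℂ) h.1 (hη.of_le (by simp)) x).congr_deriv ?_
  simpa [convolution] using hweak

theorem inner_translate_eq_convolution {φ : L2} {ψ : ℝ → ℂ} (hφ : φ =ᵐ[volume] ψ) (f : L2)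
    (x : ℝ) : inner ℂ (tfShift (x, 0) φ) f = (f ⋆[.mul ℝ ℂ] fun y => conj (ψ (-y))) x := by
  rw [L2.inner_def, convolution]
  refine integral_congr_ae ?_
  filter_upwards [tfShift_ae (x, 0) φ, shiftFun_congr (x, 0) hφ] with t hshift hψ
  rw [hshift, hψ, shiftFun_eq]
  simp

theorem IsNabla2.hasDerivAt_inner_translate {f u φ : L2} {ψ : ℝ → ℂ} (h : IsNabla2 f u)
    (hφ : φ =ᵐ[volume] ψ) (hψ : ContDiff ℝ ∞ ψ) (hc : HasCompactSupport ψ) (x : ℝ) :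
    HasDerivAt (fun x : ℝ => inner ℂ (tfShift (x, 0) φ) f) (inner ℂ (tfShift (x, 0) φ) u) x := by
  simp only [inner_translate_eq_convolution hφ]
  refine h.hasDerivAt_convolution (Complex.conjCLE.contDiff.comp (hψ.comp contDiff_neg)) ?_ x
  exact (hc.comp_homeomorph (Homeomorph.neg ℝ)).comp_left (g := fun z : ℂ => conj z) (by simp)

theorem IsNabla2.norm_translate_sub_le {f u : L2} (h : IsNabla2 f u) (r : ℝ) :
    ‖tfShift (r, 0) f - f‖ ≤ |r| * ‖u‖ := by
  have hweak (φ : L2) : ‖inner ℂ φ (tfShift (r, 0) f - f)‖ ≤ |r| * ‖u‖ * ‖φ‖ := by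
    refine (Lp.dense_hasCompactSupport_contDiff (E := ℝ) (F := ℂ) (μ := volume) (p := 2)
      (by simp)).induction
      (P := fun φ => ‖inner ℂ φ (tfShift (r, 0) f - f)‖ ≤ |r| * ‖u‖ * ‖φ‖) ?_
      (isClosed_le (by fun_prop) (by fun_prop)) φ
    rintro φ ⟨ψ, hφ, hc, hψ⟩
    have hmv := convex_univ.norm_image_sub_le_of_norm_hasDerivWithin_le (C := ‖φ‖ * ‖u‖)
      (fun x _ => (h.hasDerivAt_inner_translate hφ hψ hc x).hasDerivWithinAt)
      (fun x _ => (norm_inner_le_norm _ _).trans_eq (by rw [(tfShift (x, 0)).norm_map]))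
      (Set.mem_univ 0) (Set.mem_univ (-r))
    have hadj : inner ℂ (tfShift (-r, 0) φ) f = inner ℂ φ (tfShift (r, 0) f) := by
      simpa [← Prod.zero_eq_mk] using inner_tfShift_tfShift_neg (r, 0) 0 φ f |>.symm
    rw [hadj, ← Prod.zero_eq_mk, tfShift_zero, ← inner_sub_right] at hmv
    refine hmv.trans_eq ?_
    rw [sub_zero, norm_neg, Real.norm_eq_abs]
    ring
  rw [← innerSL_apply_norm ℂ]
  refine ContinuousLinearMap.opNorm_le_bound _ (by positivity) fun φ => ?_
  rw [innerSL_apply_apply, norm_inner_symm]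
  exact hweak φ

end Increments

section Gabor

variable {g h : L2}

/-- The Gabor system `(π(k, l) g)` over the integer lattice. -/
def gaborSystem (g : L2) (p : ℤ × ℤ) : L2 := latticeShift p g

@[simp]
theorem gaborSystem_zero (g : L2) : gaborSystem g 0 = g := latticeShift_zero g

theorem IsGaborRieszBasis.exists_rieszBounds (hg : IsGaborRieszBasis g) :
    ∃ A B : ℝ, 0 < A ∧ HasLowerRieszBound ℂ (gaborSystem g) A ∧
      HasUpperRieszBound ℂ (gaborSystem g) B := by
  obtain ⟨-, A, B, hA, hAB⟩ := hg
  have hfinset (s : Finset (ℤ × ℤ)) (c : ℤ × ℤ → ℂ) :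
      A * ∑ p ∈ s, ‖c p‖ ^ 2 ≤ ‖∑ p ∈ s, c p • gaborSystem g p‖ ^ 2 ∧
        ‖∑ p ∈ s, c p • gaborSystem g p‖ ^ 2 ≤ B * ∑ p ∈ s, ‖c p‖ ^ 2 := by
    have hvec := Finsupp.sum_indicator_index (s := s) c (h := fun p a => a • gaborSystem g p)
      (by simp)
    have hsq := Finsupp.sum_indicator_index (s := s) c (h := fun _ a => ‖a‖ ^ 2) (by simp)
    rw [← hvec, ← hsq]
    exact hAB _
  exact ⟨A, B, hA, fun s c => (hfinset s c).1, fun s c => (hfinset s c).2⟩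

theorem IsCanonicalDual.isRieszPair (hdual : IsCanonicalDual g h)
    (hg : IsGaborRieszBasis g) : IsRieszPair ℂ (gaborSystem g) (gaborSystem h) := by
  obtain ⟨A, B, hA, hlower, hupper⟩ := hg.exists_rieszBounds
  have hcoeff : (fun p => inner ℂ (gaborSystem g p) h) = Pi.single 0 (1 : ℂ) :=
    hlower.eq_single_of_hasSum hA (by rw [gaborSystem_zero]; exact hdual)
  have hbi (p q : ℤ × ℤ) :
      inner ℂ (gaborSystem h p) (gaborSystem g q) = if p = q then (1 : ℂ) else 0 := by
    have hqp : inner ℂ (gaborSystem g q) (gaborSystem h p) =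
        (Pi.single 0 1 : ℤ × ℤ → ℂ) (q - p) := by
      rw [← hcoeff]
      exact inner_latticeShift_latticeShift q p g h
    rw [← inner_conj_symm, hqp]
    simp [Pi.single_apply, sub_eq_zero, eq_comm, apply_ite]
  exact ⟨hupper.isBessel, hlower.isBessel_of_biorthogonal hA hg.1 hbi, hg.1, hbi⟩

/-- The diagonal entries `1 - e^{-2πi s (k + l)}` measuring how far the Gabor expansions of
`⟨T_s h - h, M_s g - g⟩` and `⟨M_{-s} h - h, T_{-s} g - g⟩` are from agreeing term by term. -/
def phaseDefect (s : ℝ) (p : ℤ × ℤ) : ℂ := 1 - 𝐞 (-(s * (p.1 + p.2)))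

theorem norm_phaseDefect_smul_id_le (s : ℝ) (p : ℤ × ℤ) :
    ‖phaseDefect s p • ContinuousLinearMap.id ℂ ℂ‖ ≤ 2 := by
  rw [norm_smul, ContinuousLinearMap.norm_id, mul_one]
  exact (norm_sub_le _ _).trans_eq (by rw [Circle.norm_coe, norm_one, one_add_one_eq_two])

/-- The diagonal operator on `ℓ²(ℤ²)` with entries `phaseDefect s p`. -/
def phaseDefectOp (s : ℝ) : lp (fun _ : ℤ × ℤ => ℂ) 2 →L[ℂ] lp (fun _ : ℤ × ℤ => ℂ) 2 :=
  lp.mapCLM (K := 2) 2 (fun p => phaseDefect s p • ContinuousLinearMap.id ℂ ℂ) zero_le_two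
    (norm_phaseDefect_smul_id_le s)

@[simp]
theorem phaseDefectOp_apply (s : ℝ) (c : lp (fun _ : ℤ × ℤ => ℂ) 2) (p : ℤ × ℤ) :
    phaseDefectOp s c p = phaseDefect s p * c p := rfl

theorem tendsto_phaseDefectOp {c : ℝ → lp (fun _ : ℤ × ℤ => ℂ) 2}
    {d : lp (fun _ : ℤ × ℤ => ℂ) 2} (hc : Tendsto c (𝓝[≠] 0) (𝓝 d)) :
    Tendsto (fun s => phaseDefectOp s (c s)) (𝓝[≠] 0) (𝓝 0) := by
  refine tendsto_mapCLM_zero (by simp) zero_le_two norm_phaseDefect_smul_id_le (fun p x => ?_) hc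
  have hcont : Continuous fun s : ℝ => phaseDefect s p * x := by
    unfold phaseDefect
    fun_prop
  simpa [phaseDefect] using (hcont.tendsto 0).mono_left nhdsWithin_le_nhds

theorem inner_gaborSystem_tfShift_sub
    (hgh : IsRieszPair ℂ (gaborSystem g) (gaborSystem h)) {z : ℝ × ℝ} (hz : z.1 * z.2 = 0)
    (p : ℤ × ℤ) :
    inner ℂ (gaborSystem h p) (tfShift z g - g)
      = 𝐞 (p.1 * z.2 - z.1 * p.2) * inner ℂ (tfShift (-z) h - h) (gaborSystem g (-p)) := by
  have hleft := hgh.inner_eq p 0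
  have hright := hgh.inner_eq 0 (-p)
  rw [gaborSystem_zero] at hleft hright
  rw [inner_sub_right, inner_sub_left, hleft, hright, mul_sub]
  congr 1
  · exact inner_latticeShift_tfShift hz p h g
  · rcases eq_or_ne p 0 with rfl | hp
    · simp
    · simp [hp]

theorem hasSum_fourierChar_mul_inner_mul_inner
    (hgh : IsRieszPair ℂ (gaborSystem g) (gaborSystem h)) (s : ℝ) :
    HasSum (fun p : ℤ × ℤ => 𝐞 (-(s * (p.1 + p.2))) *
        (inner ℂ (tfShift (s, 0) h - h) (gaborSystem g p) *
          inner ℂ (gaborSystem h p) (tfShift (0, s) g - g)))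
      (inner ℂ (tfShift (0, -s) h - h) (tfShift (-s, 0) g - g)) := by
  refine ((Equiv.neg (ℤ × ℤ)).hasSum_iff.mpr (hgh.hasSum_inner_mul_inner _ _)).congr_fun
    fun p => ?_
  have hmod : inner ℂ (gaborSystem h p) (tfShift (0, s) g - g)
      = 𝐞 (p.1 * s) * inner ℂ (tfShift (0, -s) h - h) (gaborSystem g (-p)) := by
    simpa using inner_gaborSystem_tfShift_sub hgh (z := (0, s)) (by simp) p
  have htrans : inner ℂ (gaborSystem h (-p)) (tfShift (-s, 0) g - g)
      = 𝐞 (-(s * p.2)) * inner ℂ (tfShift (s, 0) h - h) (gaborSystem g p) := by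
    simpa using inner_gaborSystem_tfShift_sub hgh (z := (-s, 0)) (by simp) (-p)
  have hphase : (𝐞 (-(s * (p.1 + p.2))) * 𝐞 (p.1 * s) : ℂ) = 𝐞 (-(s * p.2)) := by
    rw [← coe_fourierChar_add]
    ring_nf
  simp only [Function.comp_apply, Equiv.neg_apply]
  rw [htrans, hmod, ← hphase]
  ring

theorem inner_analysis_phaseDefectOp_analysis
    (hgh : IsRieszPair ℂ (gaborSystem g) (gaborSystem h)) (s : ℝ) :
    inner ℂ (hgh.isBessel_left.analysis (tfShift (s, 0) h - h))
        (phaseDefectOp s (hgh.isBessel_right.analysis (tfShift (0, s) g - g)))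
      = (1 - (𝐞 (-s ^ 2) : ℂ)) * inner ℂ (tfShift (s, 0) h) (tfShift (0, s) g) := by
  rw [← inner_tfShift_sub_sub_inner_tfShift_sub]
  refine (lp.hasSum_inner _ _).unique
    (((hgh.hasSum_inner_mul_inner _ _).sub
      (hasSum_fourierChar_mul_inner_mul_inner hgh s)).congr_fun fun p => ?_)
  rw [phaseDefectOp_apply, IsBessel.analysis_apply, IsBessel.analysis_apply, RCLike.inner_apply,
    inner_conj_symm, phaseDefect]
  ring

theorem tendsto_inv_sq_mul_one_sub_fourierChar_mul {c : ℝ → ℂ} {d : ℂ}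
    (hc : Tendsto c (𝓝[≠] 0) (𝓝 d)) :
    Tendsto (fun s : ℝ => (s ^ 2 : ℂ)⁻¹ * ((1 - (𝐞 (-s ^ 2) : ℂ)) * c s)) (𝓝[≠] 0)
      (𝓝 (2 * Real.pi * Complex.I * d)) := by
  have hsq : Tendsto (fun s : ℝ => -s ^ 2) (𝓝[≠] 0) (𝓝[≠] 0) := by
    refine tendsto_nhdsWithin_iff.mpr ⟨?_, ?_⟩
    · simpa using ((by fun_prop : Continuous fun s : ℝ => -s ^ 2).tendsto 0).mono_left
        nhdsWithin_le_nhds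
    · filter_upwards [self_mem_nhdsWithin] with s hs
      simpa using hs
  have hslope := ((tendsto_inv_mul_fourierChar_sub_one 1).comp hsq).mul hc
  rw [Complex.ofReal_one, mul_one] at hslope
  refine hslope.congr fun s => ?_
  simp only [Function.comp_apply, mul_one]
  push_cast
  ring

theorem tendsto_inv_sq_mul_inner_zero
    (hgh : IsRieszPair ℂ (gaborSystem g) (gaborSystem h)) {g' u : L2}
    (hg : HasDerivAt (fun s : ℝ => tfShift (0, s) g) g' 0) (hu : IsNabla2 h u) :
    Tendsto (fun s : ℝ => (s ^ 2 : ℂ)⁻¹ * ((1 - (𝐞 (-s ^ 2) : ℂ)) *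
      inner ℂ (tfShift (s, 0) h) (tfShift (0, s) g))) (𝓝[≠] 0) (𝓝 0) := by
  let V := hgh.isBessel_left.analysis
  let W := hgh.isBessel_right.analysis
  let a (s : ℝ) : L2 := (s : ℂ)⁻¹ • (tfShift (0, s) g - g)
  let b (s : ℝ) : L2 := (s : ℂ)⁻¹ • (tfShift (s, 0) h - h)
  have ha : Tendsto a (𝓝[≠] 0) (𝓝 g') := by
    simpa [a, ← Prod.zero_eq_mk, RCLike.real_smul_eq_coe_smul (K := ℂ)]
      using hg.tendsto_slope_zero
  have hb (s : ℝ) : ‖V (b s)‖ ≤ ‖V‖ * ‖u‖ := by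
    refine V.le_opNorm_of_le ?_
    rw [norm_smul, norm_inv, Complex.norm_real]
    exact inv_mul_le_of_le_mul₀ (norm_nonneg _) (norm_nonneg _) (hu.norm_translate_sub_le s)
  have hdefect : Tendsto (fun s => ‖phaseDefectOp s (W (a s))‖) (𝓝[≠] 0) (𝓝 0) := by
    simpa using (tendsto_phaseDefectOp ((W.continuous.tendsto _).comp ha)).norm
  have hinner (s : ℝ) : ‖(s ^ 2 : ℂ)⁻¹ * ((1 - (𝐞 (-s ^ 2) : ℂ)) *
      inner ℂ (tfShift (s, 0) h) (tfShift (0, s) g))‖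
      ≤ ‖V‖ * ‖u‖ * ‖phaseDefectOp s (W (a s))‖ := by
    have heq : (s ^ 2 : ℂ)⁻¹ * ((1 - (𝐞 (-s ^ 2) : ℂ)) *
        inner ℂ (tfShift (s, 0) h) (tfShift (0, s) g))
        = inner ℂ (V (b s)) (phaseDefectOp s (W (a s))) := by
      rw [← inner_analysis_phaseDefectOp_analysis hgh]
      simp only [a, b, map_smul, inner_smul_left, inner_smul_right, V, W, map_inv₀,
        Complex.conj_ofReal]
      ring
    rw [heq]
    exact (norm_inner_le_norm _ _).trans (by gcongr; exact hb s)
  refine squeeze_zero_norm hinner ?_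
  simpa using hdefect.const_mul (‖V‖ * ‖u‖)

theorem not_isNabla2_of_hasDerivAt_modulation
    (hgh : IsRieszPair ℂ (gaborSystem g) (gaborSystem h)) {g' u : L2}
    (hg : HasDerivAt (fun s : ℝ => tfShift (0, s) g) g' 0) : ¬ IsNabla2 h u := by
  intro hu
  have hg0 : Tendsto (fun s : ℝ => tfShift (0, s) g) (𝓝[≠] 0) (𝓝 g) := by
    simpa [← Prod.zero_eq_mk] using hg.continuousAt.tendsto.mono_left nhdsWithin_le_nhds
  have hh0 : Tendsto (fun s : ℝ => tfShift (s, 0) h) (𝓝[≠] 0) (𝓝 h) := by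
    refine tendsto_iff_norm_sub_tendsto_zero.mpr
      (squeeze_zero (fun _ => norm_nonneg _) hu.norm_translate_sub_le ?_)
    simpa using (((by fun_prop : Continuous fun s : ℝ => |s| * ‖u‖).tendsto 0).mono_left
      nhdsWithin_le_nhds)
  have hone : inner ℂ h g = (1 : ℂ) := by simpa using hgh.inner_eq 0 0
  have hlim := tendsto_nhds_unique (tendsto_inv_sq_mul_inner_zero hgh hg hu)
    (tendsto_inv_sq_mul_one_sub_fourierChar_mul (hh0.inner hg0))
  simp [hone, Real.pi_ne_zero] at hlim

end Gabor

end BalianLow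

end

theorem theorem3p3_general (g h : BalianLow.L2)
    (hriesz : BalianLow.IsGaborRieszBasis g)
    (hdual : BalianLow.IsCanonicalDual g h) :
    ¬ MemLp (BalianLow.nabla1 g) 2 volume ∨
      ¬ ∃ u : ℝ → ℂ, BalianLow.IsNabla2 h u ∧ MemLp u 2 volume := by
  refine not_and_or.mp fun ⟨hg, u, hu, hmem⟩ => ?_
  exact BalianLow.not_isNabla2_of_hasDerivAt_modulation (hdual.isRieszPair hriesz)
    (BalianLow.hasDerivAt_modulation hg) (hu.congr_right hmem.coeFn_toLp.symm)

theorem theorem3p3 (g h : BalianLow.L2)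
    (hgen : BalianLow.IsS0Generator g)
    (hriesz : BalianLow.IsGaborRieszBasis g)
    (hdual : BalianLow.IsCanonicalDual g h) :
    ¬ BalianLow.MemS0 (BalianLow.nabla1 g) ∨ ¬ BalianLow.Nabla2MemS0 h := by
  exact (theorem3p3_general g h hriesz hdual).imp (fun hg hS => hg hS.1)
    fun hh ⟨u, hu, hS⟩ => hh ⟨u, hu, hS.1⟩
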